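/- **Setting.** Let $d\ge 1$, $\mathbb X=[0,1]^d$ with the Euclidean norm, let $\mathbb Q_1,\dots,\mathbb Q_m\subseteq\mathbb X$ be nonempty closed sets (obstacles), $\mathbb X_{\rm free}=\mathbb X\setminus\bigcup_i\mathbb Q_i$, and $X_{\rm init},X_{\rm goal}\in\mathbb X_{\rm free}$. Assume that for some $\epsilon>0$ there is a continuous $\sigma:[0,1]\to\mathbb X_{\rm free}$ of bounded variation with $\sigma(0)=X_{\rm init}$, $\sigma(1)=X_{\rm goal}$ and $\{x\in\mathbb R^d:\|x-\sigma(s)\|<\epsilon\}\subseteq\mathbb X_{\rm free}$ for all $s\in[0,1]$. **Shapes.** For a point $X$ let $r_{i,X}$ be a minimum distance vector from $X$ to $\mathbb Q_i$ (that is, $X+r_{i,X}$ is a point of $\mathbb Q_i$ nearest to $X$; any choice is allowed), and let $\theta_{i,X}$ be the maximal angle between $r_{i,X}$ and $x-X$, $x\in\mathbb Q_i$ (with $\theta_{i,X}=\pi$ if $X\in \mathbb Q_i$). Number the obstacles by nondecreasing $\|r_{i,X}\|$. For a point $P$ let $\alpha_i$ be the angle between $r_{i,X}$ and $P-X$ (equal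 to $\pi/2$ if one of these vectors is $0$), let $\mathrm{sat}(t)=1$ for $t\ge0$ and $\mathrm{sat}(t)=0$ for $t<0$, and put $$\ell_i=\mathrm{sat}(\alpha_i-\theta_{i,X}),\quad f_i=\mathrm{sat}(\theta_{i,X}-\alpha_i)+\mathrm{sat}(\|r_{i,X}\|-\|P-X\|),\quad g_i=f_i+\sum_{j<i}\ell_j-(i+1).$$ The generalized shape $\mathcal S_X$ is the set of all $P$ such that $\ell_i=1$ for all $i$, or $g_1g_2\cdots g_m=0$. **Algorithms.** Let $X_1,X_2,\dots$ be independent and uniformly distributed on $\mathbb X_{\rm free}$. Both algorithms start with $\mathbb V=\{X_{\rm init},X_{\rm goal}\}$ and $\mathbb E=\emptyset$; edges are undirected, and ties are broken arbitrarily. In the $n$-th iteration, *GSE* takes a vertex $X_{\rm near}\in\mathbb V$ nearest to $X_n$ and forms $X_{{\rm new},g}$, which is $X_n$ if $X_n\in\mathcal S_{X_{\rm near}}$, and otherwise a point where the segment $X_{\rm near}X_n$ meets the boundary of $\mathcal S_{X_{\rm near}}$. It adds the edge $\{v,X_{{\rm new},g}\}$ for every $v$ in the current $\mathbb V$ for which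 $\mathcal S_v\cap\mathcal S_{X_{{\rm new},g}}$ meets the segment $vX_{{\rm new},g}$, and it adds $X_{{\rm new},g}$ (and possibly $X_n$ as well) to $\mathbb V$. *GSE\** has parameters $\eta,\gamma>0$. In the $n$-th iteration it computes $X_{\rm near}$, $X_{{\rm new},g}$ and the edges $\{v,X_{{\rm new},g}\}$ as GSE does (from its own current graph). It also forms a point $X_{\rm new}$ which minimizes $\|z-X_n\|$ over all $z\in\mathbb X_{\rm free}$ with $\|z-X_{\rm near}\|\le\eta$ (if there is no minimizer, $X_{\rm new}$ is any point $z$ of the segment $X_{\rm near}X_n$ with $\|z-X_{\rm near}\|\le\eta$). It adds $X_{{\rm new},g}$ and $X_{\rm new}$ to $\mathbb V$, and then the edge $\{u,X_{\rm new}\}$ for every $u\in\mathbb V\cap\mathcal S_{X_{\rm new}}$ with $\|u-X_{\rm new}\|<\min\{\gamma(\log|\mathbb V|/|\mathbb V|)^{1/d},\eta\}$. **Claim.** Let $F_n$ and $F_n^\star$ be the events that the graph of GSE, respectively of GSE\*, after $n$ iterations contains no path between $X_{\rm init}$ and $X_{\rm goal}$. (If tie-breaking makes such an event non-measurable, its probability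 is the outer probability.) Then: 1. GSE\* is probabilistically complete: $\limsup_{n\to\infty}\mathbb P(F_n^\star)=0$. 2. GSE is probabilistically complete: $\limsup_{n\to\infty}\mathbb P(F_n)=0$. 3. The failure probability of GSE decays exponentially: there are $a,b>0$, not depending on the tie-breaking, such that $\mathbb P(F_n)\le a\,e^{-bn}$ for all $n\ge0$. -/

import Mathlib

open MeasureTheory ProbabilityTheory Filter

/-- Points of the workspace, with the Euclidean norm. -/
abbrev Pt (d : ℕ) := EuclideanSpace ℝ (Fin d)

namespace GSE

noncomputable section

/-- The configuration space `[0,1]^d`. -/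
def cube (d : ℕ) : Set (Pt d) := {x | ∀ i, x i ∈ Set.Icc (0 : ℝ) 1}

/-- The free space `[0,1]^d` minus the union of the obstacles `Q 0, …, Q (m-1)`. -/
def free {d m : ℕ} (Q : Fin m → Set (Pt d)) : Set (Pt d) := cube d \ ⋃ i, Q i

/-! ### Paths -/

/-- A path: a continuous map `[0,1] → [0,1]^d` of bounded variation. -/
def IsPath {d : ℕ} (σ : unitInterval → Pt d) : Prop :=
  Continuous σ ∧ BoundedVariationOn σ Set.univ ∧ ∀ t, σ t ∈ cube d

/-- A collision-free path from `xInit` to `xGoal`. -/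
def IsFeasiblePath {d m : ℕ} (Q : Fin m → Set (Pt d)) (xInit xGoal : Pt d)
    (σ : unitInterval → Pt d) : Prop :=
  IsPath σ ∧ (∀ t, σ t ∈ free Q) ∧ σ 0 = xInit ∧ σ 1 = xGoal

/-- Strong `δ`-clearance: the open `δ`-ball about each point of the path is in the free space. -/
def HasStrongClearance {d m : ℕ} (Q : Fin m → Set (Pt d)) (δ : ℝ)
    (σ : unitInterval → Pt d) : Prop :=
  ∀ t, Metric.ball (σ t) δ ⊆ free Q

/-! ### The generalized shape -/

/-- `v` is a minimum distance vector from `X` to the obstacle `O`: it leads from `X` to a point of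
`O` nearest to `X`. -/
def IsMinDistVec {d : ℕ} (O : Set (Pt d)) (X v : Pt d) : Prop :=
  X + v ∈ O ∧ ∀ q ∈ O, ‖v‖ ≤ ‖q - X‖

open Classical in
/-- The angle `θ_{i,X}`: the maximal angle between the minimum distance vector `r i X` and the
vectors from `X` to the points of `Q i`. If `X` lies on the obstacle, then `r i X = 0` and this
angle is not defined; it is then taken to be `π` (so that the shape about `X` is `{X}`). -/
def theta {d m : ℕ} (Q : Fin m → Set (Pt d)) (r : Fin m → Pt d → Pt d) (i : Fin m) (X : Pt d) :
    ℝ :=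
  if X ∈ Q i then Real.pi
  else sSup ((fun x => InnerProductGeometry.angle (r i X) (x - X)) '' Q i)

/-- `sat x = 1` if `x ≥ 0`, and `0` otherwise. -/
def sat (x : ℝ) : ℤ := if 0 ≤ x then 1 else 0

/-- The obstacle that is `k`-th (from `0`) in a numbering by nondecreasing distance from `X`. -/
def nth {d m : ℕ} (r : Fin m → Pt d → Pt d) (X : Pt d) (k : Fin m) : Fin m :=
  Tuple.sort (fun i => ‖r i X‖) k

/-- `1` if `P` is outside the (open) cone about `r i X` with half-angle `θ_{i,X}`, where `i` is the
`k`-th obstacle. -/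
def shapeEll {d m : ℕ} (Q : Fin m → Set (Pt d)) (r : Fin m → Pt d → Pt d) (P X : Pt d)
    (k : Fin m) : ℤ :=
  sat (InnerProductGeometry.angle (r (nth r X k) X) (P - X) - theta Q r (nth r X k) X)

/-- `2` if `P` is in the closed cone of the `k`-th obstacle and not further away from `X` than this
obstacle. -/
def shapeF {d m : ℕ} (Q : Fin m → Set (Pt d)) (r : Fin m → Pt d → Pt d) (P X : Pt d)
    (k : Fin m) : ℤ :=
  sat (theta Q r (nth r X k) X - InnerProductGeometry.angle (r (nth r X k) X) (P - X))
    + sat (‖r (nth r X k) X‖ - ‖P - X‖)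

/-- `g_i = f_i + ∑_{j < i} ℓ_j - (i + 1)` for `i = k + 1`, as `k` counts from `0`. -/
def shapeG {d m : ℕ} (Q : Fin m → Set (Pt d)) (r : Fin m → Pt d → Pt d) (P X : Pt d)
    (k : Fin m) : ℤ :=
  shapeF Q r P X k + ∑ j ∈ Finset.Iio k, shapeEll Q r P X j - ((k : ℕ) + 2 : ℤ)

open Classical in
/-- The procedure `Shape(P, X, X_obs)`. -/
def shapeFun {d m : ℕ} (Q : Fin m → Set (Pt d)) (r : Fin m → Pt d → Pt d) (P X : Pt d) : ℤ :=
  if ∀ k, shapeEll Q r P X k = 1 then 0 else ∏ k, shapeG Q r P X k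

/-- The generalized shape `S_X` about `X`. -/
def shape {d m : ℕ} (Q : Fin m → Set (Pt d)) (r : Fin m → Pt d → Pt d) (X : Pt d) : Set (Pt d) :=
  {P | shapeFun Q r P X = 0}

/-! ### The subroutines -/

/-- A graph with vertices in the workspace; edges are unordered pairs. -/
structure PlanGraph (d : ℕ) where
  V : Set (Pt d)
  E : Set (Sym2 (Pt d))

/-- The graph before the first iteration. -/
def initGraph {d : ℕ} (xInit xGoal : Pt d) : PlanGraph d := ⟨{xInit, xGoal}, ∅⟩

/-- `z` is a vertex nearest to `x`. -/
def IsNearest {d : ℕ} (V : Set (Pt d)) (x z : Pt d) : Prop :=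
  z ∈ V ∧ ∀ w ∈ V, ‖z - x‖ ≤ ‖w - x‖

/-- `z` is a result of `Steer-GSE(X, Y)`: it is `Y` if `Y` lies in the shape about `X`, and
otherwise a point where the segment from `X` to `Y` meets the boundary of this shape. -/
def IsSteerGSE {d m : ℕ} (Q : Fin m → Set (Pt d)) (r : Fin m → Pt d → Pt d) (X Y z : Pt d) :
    Prop :=
  (Y ∈ shape Q r X ∧ z = Y) ∨
    (Y ∉ shape Q r X ∧ z ∈ frontier (shape Q r X) ∩ segment ℝ X Y)

/-- `z` is a point of the free space within distance `η` of `X` which is closest to `Y` among all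
such points. -/
def IsSteerMin {d m : ℕ} (Q : Fin m → Set (Pt d)) (η : ℝ) (X Y z : Pt d) : Prop :=
  z ∈ Metric.closedBall X η ∩ free Q ∧ ∀ w ∈ Metric.closedBall X η ∩ free Q, ‖z - Y‖ ≤ ‖w - Y‖

/-- `z` is a result of `Steer(X, Y, η)`. As the free space need not be closed, a closest point need
not exist; the result is then any point of the ball that lies on the segment from `X` to `Y`. -/
def IsSteer {d m : ℕ} (Q : Fin m → Set (Pt d)) (η : ℝ) (X Y z : Pt d) : Prop :=
  IsSteerMin Q η X Y z ∨
    ((¬ ∃ w, IsSteerMin Q η X Y w) ∧ z ∈ Metric.closedBall X η ∩ segment ℝ X Y)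

/-- The vertices `X` whose shape meets the shape about `Y` on the segment from `X` to `Y`. -/
def intersectShape {d m : ℕ} (Q : Fin m → Set (Pt d)) (r : Fin m → Pt d → Pt d) (V : Set (Pt d))
    (Y : Pt d) : Set (Pt d) :=
  {X ∈ V | (shape Q r X ∩ shape Q r Y ∩ segment ℝ X Y).Nonempty}

/-- The connection radius `min (γ (log |V| / |V|)^(1/d)) η`. -/
def connRadius {d : ℕ} (η γ : ℝ) (V : Set (Pt d)) : ℝ :=
  min (γ * (Real.log V.ncard / V.ncard) ^ (1 / (d : ℝ))) η

/-! ### The algorithms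

The outcome of an iteration need not be unique (ties). Each algorithm is therefore given by the
relation between the sample, the graph before and the possible graphs after an iteration. -/

/-- One iteration of GSE with the sample `x`. The vertex set receives the new vertex, with or
without the raw sample. -/
def GSEStep {d m : ℕ} (Q : Fin m → Set (Pt d)) (r : Fin m → Pt d → Pt d) (x : Pt d)
    (G G' : PlanGraph d) : Prop :=
  ∃ xNear xNew : Pt d,
    IsNearest G.V x xNear ∧
    IsSteerGSE Q r xNear x xNew ∧
    (G'.V = G.V ∪ {xNew, x} ∨ G'.V = G.V ∪ {xNew}) ∧
    G'.E = G.E ∪ (fun v => s(v, xNew)) '' intersectShape Q r G.V xNew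

/-- One iteration of GSE* with the sample `x`. -/
def GSEStarStep {d m : ℕ} (Q : Fin m → Set (Pt d)) (r : Fin m → Pt d → Pt d) (η γ : ℝ) (x : Pt d)
    (G G' : PlanGraph d) : Prop :=
  ∃ xNear xNewG xNew : Pt d,
    IsNearest G.V x xNear ∧
    IsSteerGSE Q r xNear x xNewG ∧
    IsSteer Q η xNear x xNew ∧
    G'.V = G.V ∪ {xNewG, xNew} ∧
    G'.E = G.E
      ∪ (fun v => s(v, xNewG)) '' intersectShape Q r G.V xNewG
      ∪ (fun u => s(u, xNew)) ''
          (G'.V ∩ Metric.ball xNew (connRadius η γ G'.V) ∩ shape Q r xNew)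

/-- `G n` is the graph after `n` iterations in a run of GSE on the samples `x 0, x 1, …`. -/
def IsGSERun {d m : ℕ} (Q : Fin m → Set (Pt d)) (r : Fin m → Pt d → Pt d) (xInit xGoal : Pt d)
    (x : ℕ → Pt d) (G : ℕ → PlanGraph d) : Prop :=
  G 0 = initGraph xInit xGoal ∧ ∀ n, GSEStep Q r (x n) (G n) (G (n + 1))

/-- `G n` is the graph after `n` iterations in a run of GSE* on the samples `x 0, x 1, …`. -/
def IsGSEStarRun {d m : ℕ} (Q : Fin m → Set (Pt d)) (r : Fin m → Pt d → Pt d) (η γ : ℝ)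
    (xInit xGoal : Pt d) (x : ℕ → Pt d) (G : ℕ → PlanGraph d) : Prop :=
  G 0 = initGraph xInit xGoal ∧ ∀ n, GSEStarStep Q r η γ (x n) (G n) (G (n + 1))

/-- There is a path between `a` and `b` in the graph. -/
def PlanGraph.Joins {d : ℕ} (G : PlanGraph d) (a b : Pt d) : Prop :=
  (SimpleGraph.fromEdgeSet G.E).Reachable a b

/-- The probability that the `n`-th graph has no path from `xInit` to `xGoal`. -/
def failProb {d : ℕ} {Ω : Type*} [MeasurableSpace Ω] (μ : Measure Ω) (xInit xGoal : Pt d)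
    (G : Ω → ℕ → PlanGraph d) (n : ℕ) : ENNReal :=
  μ {ω | ¬ (G ω n).Joins xInit xGoal}

end

end GSE

namespace GSE

/-! The shape about a point contains every collision-free ball about it
(`mem_shape_of_ball_subset`). So if a sample `x` has clearance `2ρ` and some vertex lies within `ρ`
of it, then the nearest vertex has clearance `ρ`, steering returns `x` itself, and `x` is joined to
all vertices within `ρ` (`GrowStep.joins_of_clearance`). Extra vertices and edges do no harm: they
only bring the nearest vertex closer. Hence both algorithms are treated at once through `GrowStep`.

Cut the clear path into short steps. If the samples visit small balls about the division points in
order, the graph joins the two ends (`joins_of_visits`). Allot one block of about `n / K` samples to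
each of the `K` balls: by independence and the union bound, some block misses its ball with
exponentially small probability (`measure_exists_not_visited_le`). This event involves the samples
only, so the constants are independent of tie-breaking. -/

/-! ### Balls inside the generalized shape. -/

/-- The shape about `X` contains every point that is no further from `X` than any obstacle. -/
lemma mem_shape_of_norm_le {d m : ℕ} (Q : Fin m → Set (Pt d)) (r : Fin m → Pt d → Pt d)
    {X P : Pt d} (h : ∀ i, ‖P - X‖ ≤ ‖r i X‖) : P ∈ shape Q r X := by
  classical
  show shapeFun Q r P X = 0
  unfold shapeFun
  split_ifs with hall
  · rfl
  push Not at hall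
  -- Take the first obstacle whose open cone contains `P`. All earlier `ℓ` are `1` and its `f` is
  -- `2`, so its `g` is `2 + k - (k + 2) = 0`.
  obtain ⟨k, hk, hmin⟩ := WellFounded.has_min (wellFounded_lt (α := Fin m))
    {k | shapeEll Q r P X k ≠ 1} hall
  have hlt : ∀ j ∈ Finset.Iio k, shapeEll Q r P X j = 1 := by
    intro j hj
    by_contra hne
    exact hmin j hne (Finset.mem_Iio.mp hj)
  have hneg : InnerProductGeometry.angle (r (nth r X k) X) (P - X)
      - theta Q r (nth r X k) X < 0 := by
    by_contra hge
    exact hk (by unfold shapeEll sat; rw [if_pos (not_lt.mp hge)])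
  refine Finset.prod_eq_zero (Finset.mem_univ k) ?_
  unfold shapeG shapeF
  rw [Finset.sum_congr rfl hlt]
  have h1 : sat (theta Q r (nth r X k) X
      - InnerProductGeometry.angle (r (nth r X k) X) (P - X)) = 1 := by
    unfold sat; rw [if_pos (by linarith)]
  have h2 : sat (‖r (nth r X k) X‖ - ‖P - X‖) = 1 := by
    unfold sat; rw [if_pos (by linarith [h (nth r X k)])]
  rw [h1, h2]
  simp
  ring

/-- The shape about `X` contains every collision-free ball about `X`. -/
lemma mem_shape_of_ball_subset {d m : ℕ} {Q : Fin m → Set (Pt d)} {r : Fin m → Pt d → Pt d}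
    (hr : ∀ i X, IsMinDistVec (Q i) X (r i X)) {X P : Pt d} {ρ : ℝ}
    (hball : Metric.ball X ρ ⊆ free Q) (hP : dist P X ≤ ρ) : P ∈ shape Q r X := by
  refine mem_shape_of_norm_le Q r fun i => ?_
  rw [← dist_eq_norm]
  refine hP.trans ?_
  by_contra hlt
  have hmem : X + r i X ∈ Metric.ball X ρ := by
    simpa [Metric.mem_ball, dist_eq_norm] using not_le.mp hlt
  exact (hball hmem).2 (Set.mem_iUnion.mpr ⟨i, (hr i X).1⟩)

/-! ### Growth of the graph along a chain of samples. -/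

/-- What GSE and GSE* have in common: the vertex found by `Steer-GSE` and its edges are added,
possibly among others. -/
def GrowStep {d m : ℕ} (Q : Fin m → Set (Pt d)) (r : Fin m → Pt d → Pt d) (x : Pt d)
    (G G' : PlanGraph d) : Prop :=
  ∃ xNear xNew : Pt d,
    IsNearest G.V x xNear ∧
    IsSteerGSE Q r xNear x xNew ∧
    G.V ∪ {xNew} ⊆ G'.V ∧
    G.E ∪ (fun v => s(v, xNew)) '' intersectShape Q r G.V xNew ⊆ G'.E

section Steps

variable {d m : ℕ} {Q : Fin m → Set (Pt d)} {r : Fin m → Pt d → Pt d}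

lemma GSEStep.growStep {x : Pt d} {G G' : PlanGraph d} (h : GSEStep Q r x G G') :
    GrowStep Q r x G G' := by
  obtain ⟨xNear, xNew, h1, h2, h3, h4⟩ := h
  refine ⟨xNear, xNew, h1, h2, ?_, h4.ge⟩
  rcases h3 with h3 | h3
  · rw [h3]
    exact Set.union_subset_union_right _ (by simp)
  · exact h3.ge

lemma GSEStarStep.growStep {η γ : ℝ} {x : Pt d} {G G' : PlanGraph d}
    (h : GSEStarStep Q r η γ x G G') : GrowStep Q r x G G' := by
  obtain ⟨xNear, xNewG, xNew, h1, h2, -, h3, h4⟩ := h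
  refine ⟨xNear, xNewG, h1, h2, ?_, ?_⟩
  · rw [h3]
    exact Set.union_subset_union_right _ (by simp)
  · rw [h4]
    exact Set.subset_union_left

lemma PlanGraph.Joins.mono {G G' : PlanGraph d} (h : G.E ⊆ G'.E) {a b : Pt d}
    (hab : G.Joins a b) : G'.Joins a b :=
  SimpleGraph.Reachable.mono (SimpleGraph.fromEdgeSet_mono h) hab

lemma PlanGraph.joins_of_mem {G : PlanGraph d} {a b : Pt d} (h : s(a, b) ∈ G.E) :
    G.Joins a b := by
  -- `fromEdgeSet` discards loops, which arise when the new vertex is already present.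
  by_cases hab : a = b
  · subst hab
    exact SimpleGraph.Reachable.refl _
  · exact SimpleGraph.Adj.reachable ((SimpleGraph.fromEdgeSet_adj _).mpr ⟨h, hab⟩)

lemma GrowStep.vertices_subset {x : Pt d} {G G' : PlanGraph d} (h : GrowStep Q r x G G') :
    G.V ⊆ G'.V := by
  obtain ⟨_, _, _, _, h3, _⟩ := h
  exact Set.subset_union_left.trans h3

lemma GrowStep.edges_subset {x : Pt d} {G G' : PlanGraph d} (h : GrowStep Q r x G G') :
    G.E ⊆ G'.E := by
  obtain ⟨_, _, _, _, _, h4⟩ := h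
  exact Set.subset_union_left.trans h4

/-- A sample with enough clearance, relative to its distance from the graph, becomes a vertex that
is joined to all the vertices near it. -/
lemma GrowStep.joins_of_clearance (hr : ∀ i X, IsMinDistVec (Q i) X (r i X)) {x : Pt d}
    {G G' : PlanGraph d} (h : GrowStep Q r x G G') {ρ : ℝ} (hρ : 0 ≤ ρ)
    (hclear : Metric.ball x (2 * ρ) ⊆ free Q) (hw : ∃ w ∈ G.V, dist w x ≤ ρ) :
    x ∈ G'.V ∧ ∀ v ∈ G.V, dist v x ≤ ρ → G'.Joins v x := by
  obtain ⟨xNear, xNew, h1, h2, h3, h4⟩ := h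
  obtain ⟨w, hwV, hwx⟩ := hw
  have key : ∀ v : Pt d, dist v x ≤ ρ → x ∈ shape Q r v := by
    intro v hv
    refine mem_shape_of_ball_subset hr (ρ := ρ) ?_ (by rwa [dist_comm])
    exact (Metric.ball_subset_ball' (by linarith)).trans hclear
  have hnear : dist xNear x ≤ ρ := by
    have := h1.2 w hwV
    rw [← dist_eq_norm, ← dist_eq_norm] at this
    exact this.trans hwx
  have hnew : xNew = x := by
    rcases h2 with h2 | h2
    · exact h2.2
    · exact absurd (key _ hnear) h2.1
  subst hnew
  refine ⟨h3 (Or.inr rfl), fun v hv hvx => ?_⟩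
  -- The two shapes meet at `xNew` itself, an endpoint of the segment.
  refine PlanGraph.joins_of_mem (h4 (Or.inr ⟨v, ⟨hv, xNew, ⟨key v hvx, key xNew ?_⟩, ?_⟩, rfl⟩))
  · simpa using hρ
  · exact right_mem_segment ℝ v xNew

lemma vertices_mono {x : ℕ → Pt d} {G : ℕ → PlanGraph d}
    (hG : ∀ n, GrowStep Q r (x n) (G n) (G (n + 1))) {k n : ℕ} (hkn : k ≤ n) :
    (G k).V ⊆ (G n).V :=
  monotone_nat_of_le_succ (f := fun n => (G n).V) (fun n => (hG n).vertices_subset) hkn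

lemma edges_mono {x : ℕ → Pt d} {G : ℕ → PlanGraph d}
    (hG : ∀ n, GrowStep Q r (x n) (G n) (G (n + 1))) {k n : ℕ} (hkn : k ≤ n) :
    (G k).E ⊆ (G n).E :=
  monotone_nat_of_le_succ (f := fun n => (G n).E) (fun n => (hG n).edges_subset) hkn

/-- If the samples visit in turn small balls along a chain of points with clearance, then the graph
contains a path from `xInit` to the end of the chain. -/
lemma joins_of_visits (hr : ∀ i X, IsMinDistVec (Q i) X (r i X)) {xInit xGoal : Pt d}
    {x : ℕ → Pt d} {G : ℕ → PlanGraph d} (h0 : G 0 = initGraph xInit xGoal)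
    (hG : ∀ n, GrowStep Q r (x n) (G n) (G (n + 1))) {δ : ℝ} (hδ : 0 < δ) {p : ℕ → Pt d} {K : ℕ}
    (hK : 0 < K) (hp0 : p 0 = xInit) (hpK : p K = xGoal)
    (hclear : ∀ j ≤ K, Metric.ball (p j) (8 * δ) ⊆ free Q)
    (hstep : ∀ j < K, dist (p j) (p (j + 1)) < δ) {L : ℕ}
    (hvisit : ∀ j < K, ∃ i, j * L ≤ i ∧ i < (j + 1) * L ∧ x i ∈ Metric.ball (p (j + 1)) δ)
    {n : ℕ} (hn : K * L ≤ n) : (G n).Joins xInit xGoal := by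
  have hinit : xInit ∈ (G 0).V := by rw [h0]; exact Or.inl rfl
  have hgoal : xGoal ∈ (G 0).V := by rw [h0]; exact Or.inr rfl
  -- The goal is a vertex from the start, so it needs no visit of its own: a sample in a ball whose
  -- center is near the goal is joined to it. Stage `0` has no sample yet, hence `0 < j`.
  have inv : ∀ j ≤ K, (∃ w ∈ (G (j * L)).V, dist w (p j) < δ ∧ (G (j * L)).Joins xInit w) ∧
      (0 < j → dist xGoal (p j) < δ → (G (j * L)).Joins xInit xGoal) := by
    intro j
    induction j with
    | zero =>
      intro _
      refine ⟨⟨xInit, vertices_mono hG (Nat.zero_le _) hinit, by simpa [hp0] using hδ,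
        SimpleGraph.Reachable.refl _⟩, fun h => absurd h (lt_irrefl 0)⟩
    | succ j ih =>
      intro hj
      obtain ⟨⟨w, hwV, hwp, hjoin⟩, -⟩ := ih (by omega)
      obtain ⟨i, hi1, hi2, hxi⟩ := hvisit j (by omega)
      rw [Metric.mem_ball] at hxi
      have hwV' := vertices_mono hG hi1 hwV
      have hwx : dist w (x i) ≤ 3 * δ := by
        have h1 := dist_triangle4 w (p j) (p (j + 1)) (x i)
        have h2 := hstep j (by omega)
        rw [dist_comm (p (j + 1)) (x i)] at h1
        linarith
      -- `3 * δ` covers the three hops from `w` to `x i`; the sample then needs clearance `6 * δ`,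
      -- and lies within `δ` of a point with clearance `8 * δ`.
      obtain ⟨hxV, hxJ⟩ := (hG i).joins_of_clearance hr (ρ := 3 * δ) (by linarith)
        ((Metric.ball_subset_ball' (by linarith)).trans (hclear (j + 1) hj)) ⟨w, hwV', hwx⟩
      have hle : i + 1 ≤ (j + 1) * L := hi2
      have hx : (G ((j + 1) * L)).Joins xInit (x i) :=
        SimpleGraph.Reachable.trans (hjoin.mono (edges_mono hG (hi1.trans (by omega))))
          ((hxJ w hwV' hwx).mono (edges_mono hG hle))
      refine ⟨⟨x i, vertices_mono hG hle hxV, hxi, hx⟩, fun _ hg => ?_⟩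
      have hgx : dist xGoal (x i) ≤ 3 * δ := by
        have := dist_triangle_right xGoal (x i) (p (j + 1))
        linarith
      exact hx.trans (SimpleGraph.Reachable.symm ((hxJ xGoal
        (vertices_mono hG (Nat.zero_le _) hgoal) hgx).mono (edges_mono hG hle)))
  exact ((inv K le_rfl).2 hK (by simpa [hpK] using hδ)).mono (edges_mono hG hn)

end Steps

/-! ### Hitting probabilities of independent uniform samples. -/

/-- If independent samples hit each of `K` sets with probability at least `p`, then they hit these
sets in turn, in `K` successive blocks of length `L`, up to a probability exponentially small
in `L`. -/
lemma measure_exists_not_visited_le {Ω E : Type*} [MeasurableSpace Ω] [MeasurableSpace E]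
    {μ : Measure Ω} [IsProbabilityMeasure μ] {X : ℕ → Ω → E} (hX : ∀ n, Measurable (X n))
    (hind : iIndepFun X μ) {B : ℕ → Set E} (hB : ∀ j, MeasurableSet (B j)) {p : ℝ}
    {K : ℕ} (hp : ∀ n, ∀ j < K, ENNReal.ofReal p ≤ μ (X n ⁻¹' B j)) (L : ℕ) :
    μ {ω | ¬ ∀ j < K, ∃ i, j * L ≤ i ∧ i < (j + 1) * L ∧ X i ω ∈ B j} ≤
      ENNReal.ofReal (K * Real.exp (-p * L)) := by
  have hmiss : ∀ n, ∀ j < K, μ (X n ⁻¹' (B j)ᶜ) ≤ ENNReal.ofReal (Real.exp (-p)) := by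
    intro n j hj
    rw [Set.preimage_compl, prob_compl_eq_one_sub (hX n (hB j))]
    calc 1 - μ (X n ⁻¹' B j) ≤ 1 - ENNReal.ofReal p := tsub_le_tsub_left (hp n j hj) 1
      _ ≤ ENNReal.ofReal (Real.exp (-p)) := by
        rw [tsub_le_iff_right]
        -- The estimate is `1 - p ≤ exp (-p)`; for `p ≤ 0` the right side is already at least `1`.
        rcases le_total p 0 with h | h
        · refine le_add_right ?_
          rw [← ENNReal.ofReal_one]
          exact ENNReal.ofReal_le_ofReal (Real.one_le_exp (by linarith))
        · rw [← ENNReal.ofReal_add (Real.exp_pos _).le h, ← ENNReal.ofReal_one]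
          exact ENNReal.ofReal_le_ofReal (by linarith [Real.add_one_le_exp (-p)])
  have hblock : ∀ j < K, μ (⋂ i ∈ Finset.Ico (j * L) ((j + 1) * L), X i ⁻¹' (B j)ᶜ) ≤
      ENNReal.ofReal (Real.exp (-p * L)) := by
    intro j hj
    rw [hind.measure_inter_preimage_eq_mul _ (fun i _ => (hB j).compl)]
    calc ∏ i ∈ Finset.Ico (j * L) ((j + 1) * L), μ (X i ⁻¹' (B j)ᶜ)
        ≤ ∏ _i ∈ Finset.Ico (j * L) ((j + 1) * L), ENNReal.ofReal (Real.exp (-p)) :=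
          Finset.prod_le_prod' fun i _ => hmiss i j hj
      _ = ENNReal.ofReal (Real.exp (-p * L)) := by
        rw [Finset.prod_const, Nat.card_Ico, ← ENNReal.ofReal_pow (Real.exp_pos _).le,
          ← Real.exp_nat_mul, add_mul, one_mul, Nat.add_sub_cancel_left, mul_comm (L : ℝ)]
  calc μ {ω | ¬ ∀ j < K, ∃ i, j * L ≤ i ∧ i < (j + 1) * L ∧ X i ω ∈ B j}
      ≤ μ (⋃ j ∈ Finset.range K, ⋂ i ∈ Finset.Ico (j * L) ((j + 1) * L), X i ⁻¹' (B j)ᶜ) := by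
        refine measure_mono fun ω hω => ?_
        simp only [Set.mem_ofPred_eq, not_forall] at hω
        obtain ⟨j, hj, hno⟩ := hω
        simp only [Set.mem_iUnion, Set.mem_iInter, Finset.mem_range, Finset.mem_Ico]
        exact ⟨j, hj, fun i hi hmem => hno ⟨i, hi.1, hi.2, hmem⟩⟩
    _ ≤ ∑ j ∈ Finset.range K, μ (⋂ i ∈ Finset.Ico (j * L) ((j + 1) * L), X i ⁻¹' (B j)ᶜ) :=
        measure_biUnion_finset_le _ _
    _ ≤ ∑ _j ∈ Finset.range K, ENNReal.ofReal (Real.exp (-p * L)) :=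
        Finset.sum_le_sum fun j hj => hblock j (Finset.mem_range.mp hj)
    _ = ENNReal.ofReal (K * Real.exp (-p * L)) := by
        rw [Finset.sum_const, Finset.card_range, nsmul_eq_mul,
          ENNReal.ofReal_mul (Nat.cast_nonneg K), ENNReal.ofReal_natCast]

lemma measure_cube_lt_top (d : ℕ) : volume (cube d) < ⊤ := by
  refine Bornology.IsBounded.measure_lt_top ?_
  refine (Metric.isBounded_closedBall (x := (0 : Pt d)) (r := Real.sqrt d)).subset fun x hx => ?_
  rw [mem_closedBall_zero_iff, EuclideanSpace.norm_eq]
  refine Real.sqrt_le_sqrt ?_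
  calc ∑ i, ‖x i‖ ^ 2 ≤ ∑ _i : Fin d, (1 : ℝ) := by
        refine Finset.sum_le_sum fun i _ => ?_
        rw [Real.norm_eq_abs, sq_abs]
        exact pow_le_one₀ (hx i).1 (hx i).2
    _ = d := by simp

/-- A uniform sample hits each collision-free ball of a given radius with a probability bounded
below. -/
lemma exists_hit_prob_pos {d m : ℕ} {Q : Fin m → Set (Pt d)} {δ : ℝ} (hδ : 0 < δ)
    {Ω : Type*} [MeasurableSpace Ω] {μ : Measure Ω} {X : ℕ → Ω → Pt d}
    (hunif : ∀ n, pdf.IsUniform (X n) (free Q) μ volume) {c₀ : Pt d}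
    (hc₀ : Metric.ball c₀ δ ⊆ free Q) :
    ∃ p : ℝ, 0 < p ∧ ∀ n c, Metric.ball c δ ⊆ free Q →
      ENNReal.ofReal p ≤ μ (X n ⁻¹' Metric.ball c δ) := by
  have hfin : volume (free Q) ≠ ⊤ :=
    ((measure_mono Set.sdiff_subset).trans_lt (measure_cube_lt_top d)).ne
  have hballpos : ∀ c : Pt d, 0 < volume (Metric.ball c δ) :=
    fun c => Metric.measure_ball_pos volume c hδ
  have hpos : volume (free Q) ≠ 0 := ((hballpos c₀).trans_le (measure_mono hc₀)).ne'
  -- By translation invariance the volume ratio is the same for all centers.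
  refine ⟨(volume (Metric.ball (0 : Pt d) δ) / volume (free Q)).toReal, ?_, fun n c hc => ?_⟩
  · exact ENNReal.toReal_pos (ENNReal.div_pos (hballpos 0).ne' hfin).ne'
      (ENNReal.div_lt_top measure_ball_lt_top.ne hpos).ne
  · refine ENNReal.ofReal_toReal_le.trans ?_
    rw [(hunif n).measure_preimage hpos hfin Metric.isOpen_ball.measurableSet,
      Set.inter_eq_right.mpr hc, Measure.addHaar_ball_center volume c]

/-! ### Discretization of the path and the exponential bound. -/

/-- A continuous path can be followed in finitely many short steps. -/
lemma exists_chain {E : Type*} [PseudoMetricSpace E] {σ : unitInterval → E} (hσ : Continuous σ)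
    {δ : ℝ} (hδ : 0 < δ) : ∃ (K : ℕ) (t : ℕ → unitInterval), 0 < K ∧ t 0 = 0 ∧ t K = 1 ∧
      ∀ j < K, dist (σ (t j)) (σ (t (j + 1))) < δ := by
  obtain ⟨ρ, hρ, hσρ⟩ := Metric.uniformContinuous_iff.mp
    (CompactSpace.uniformContinuous_of_continuous hσ) δ hδ
  obtain ⟨N, hN⟩ := exists_nat_one_div_lt hρ
  have hN0 : (0 : ℝ) < (N : ℝ) + 1 := by positivity
  refine ⟨N + 1, fun j => Set.projIcc 0 1 zero_le_one ((j : ℝ) / (N + 1)), N.succ_pos, ?_, ?_,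
    fun j hj => hσρ ?_⟩
  · simp
  · beta_reduce
    rw [Nat.cast_add_one, div_self hN0.ne', Set.projIcc_right]; rfl
  · have hj' : (j : ℝ) + 1 ≤ N + 1 := by exact_mod_cast hj
    beta_reduce
    rw [Set.projIcc_of_mem zero_le_one (x := (j : ℝ) / (N + 1))
        ⟨by positivity, by rw [div_le_one hN0]; linarith⟩,
      Set.projIcc_of_mem zero_le_one (x := ((j + 1 : ℕ) : ℝ) / (N + 1))
        ⟨by positivity, by rw [div_le_one hN0]; push_cast; linarith⟩,
      Subtype.dist_eq, Real.dist_eq, abs_sub_comm]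
    push_cast
    rw [← sub_div, add_sub_cancel_left, abs_of_pos (by positivity)]
    exact hN

/-- The failure probability of every algorithm that performs the steps of GSE decays
exponentially. -/
lemma exists_failProb_le {d m : ℕ} {Q : Fin m → Set (Pt d)} {xInit xGoal : Pt d}
    (hpath : ∃ (σ : unitInterval → Pt d) (ε : ℝ), 0 < ε ∧
      IsFeasiblePath Q xInit xGoal σ ∧ HasStrongClearance Q ε σ)
    {r : Fin m → Pt d → Pt d} (hr : ∀ i X, IsMinDistVec (Q i) X (r i X))
    {Ω : Type*} [MeasurableSpace Ω] {μ : Measure Ω} [IsProbabilityMeasure μ]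
    {X : ℕ → Ω → Pt d} (hX : ∀ n, Measurable (X n)) (hind : iIndepFun X μ)
    (hunif : ∀ n, pdf.IsUniform (X n) (free Q) μ volume) :
    ∃ a b : ℝ, 0 < a ∧ 0 < b ∧ ∀ G : Ω → ℕ → PlanGraph d,
      (∀ ω, G ω 0 = initGraph xInit xGoal ∧
        ∀ n, GrowStep Q r (X n ω) (G ω n) (G ω (n + 1))) →
      ∀ n, failProb μ xInit xGoal G n ≤ ENNReal.ofReal (a * Real.exp (-b * n)) := by
  obtain ⟨σ, ε, hε, ⟨⟨hcont, -, -⟩, -, hσ0, hσ1⟩, hclear⟩ := hpath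
  obtain ⟨δ, rfl⟩ : ∃ δ, ε = 8 * δ := ⟨ε / 8, by ring⟩
  have hδ : 0 < δ := by linarith
  obtain ⟨K, t, hK, ht0, htK, hstep⟩ := exists_chain hcont hδ
  have hclear' : ∀ s, Metric.ball (σ s) δ ⊆ free Q :=
    fun s => (Metric.ball_subset_ball (by linarith)).trans (hclear s)
  obtain ⟨p, hp, hhit⟩ := exists_hit_prob_pos hδ hunif (hclear' 0)
  have hK' : (0 : ℝ) < K := Nat.cast_pos.mpr hK
  -- Blocks have length `⌊n / K⌋ > n / K - 1`; the rounding costs the factor `exp p`.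
  refine ⟨K * Real.exp p, p / K, by positivity, by positivity, fun G hG n => ?_⟩
  calc failProb μ xInit xGoal G n
      ≤ μ {ω | ¬ ∀ j < K, ∃ i, j * (n / K) ≤ i ∧ i < (j + 1) * (n / K) ∧
          X i ω ∈ Metric.ball (σ (t (j + 1))) δ} := by
        -- Monotonicity holds for the outer measure, so the failure event need not be measurable.
        refine measure_mono fun ω hω hvisit => hω ?_
        exact joins_of_visits hr (hG ω).1 (hG ω).2 hδ (p := fun j => σ (t j)) hK
          (by simp only [ht0, hσ0]) (by simp only [htK, hσ1]) (fun j _ => hclear (t j)) hstep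
          hvisit (Nat.mul_div_le n K)
    _ ≤ ENNReal.ofReal (K * Real.exp (-p * (n / K : ℕ))) :=
        measure_exists_not_visited_le hX hind
          (B := fun j => Metric.ball (σ (t (j + 1))) δ) (fun j => Metric.isOpen_ball.measurableSet)
          (fun n j _ => hhit n _ (hclear' _)) (n / K)
    _ ≤ ENNReal.ofReal (K * Real.exp p * Real.exp (-(p / K) * n)) := by
        rw [mul_assoc, ← Real.exp_add]
        refine ENNReal.ofReal_le_ofReal (mul_le_mul_of_nonneg_left ?_ hK'.le)
        refine Real.exp_le_exp.mpr ?_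
        have h1 : (n : ℝ) / K < (n / K : ℕ) + 1 := by
          rw [div_lt_iff₀ hK']
          rw [mul_comm]
          exact_mod_cast Nat.lt_mul_div_succ n hK
        have h2 : p * ((n : ℝ) / K) ≤ p * ((n / K : ℕ) + 1) :=
          mul_le_mul_of_nonneg_left h1.le hp.le
        have h3 : -(p / K) * n = -(p * ((n : ℝ) / K)) := by ring
        rw [h3]
        linarith

lemma limsup_eq_zero_of_le_exp {u : ℕ → ENNReal} {a b : ℝ} (hb : 0 < b)
    (h : ∀ n : ℕ, u n ≤ ENNReal.ofReal (a * Real.exp (-b * n))) : limsup u atTop = 0 := by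
  refine Tendsto.limsup_eq (tendsto_of_tendsto_of_tendsto_of_le_of_le tendsto_const_nhds ?_
    (fun n => zero_le) h)
  have h1 : Tendsto (fun n : ℕ => -b * (n : ℝ)) atTop atBot :=
    tendsto_natCast_atTop_atTop.const_mul_atTop_of_neg (neg_lt_zero.mpr hb)
  have h2 := (Real.tendsto_exp_atBot.comp h1).const_mul a
  rw [mul_zero] at h2
  simpa using ENNReal.tendsto_ofReal h2

end GSE

theorem mainTheorem3 {d m : ℕ} (hd : 0 < d)
    (Q : Fin m → Set (Pt d)) (hQ_closed : ∀ i, IsClosed (Q i)) (hQ_nonempty : ∀ i, (Q i).Nonempty)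
    (hQ_sub : ∀ i, Q i ⊆ GSE.cube d)
    (xInit xGoal : Pt d) (hInit : xInit ∈ GSE.free Q) (hGoal : xGoal ∈ GSE.free Q)
    (hpath : ∃ (σ : unitInterval → Pt d) (ε : ℝ), 0 < ε ∧
      GSE.IsFeasiblePath Q xInit xGoal σ ∧ GSE.HasStrongClearance Q ε σ)
    (r : Fin m → Pt d → Pt d) (hr : ∀ i X, GSE.IsMinDistVec (Q i) X (r i X))
    (η γ : ℝ) (hη : 0 < η) (hγ : 0 < γ)
    {Ω : Type*} [MeasurableSpace Ω] (μ : Measure Ω) [IsProbabilityMeasure μ]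
    (X : ℕ → Ω → Pt d) (hX_meas : ∀ n, Measurable (X n)) (hX_indep : iIndepFun X μ)
    (hX_unif : ∀ n, pdf.IsUniform (X n) (GSE.free Q) μ volume) :
    (∀ G : Ω → ℕ → GSE.PlanGraph d,
      (∀ ω, GSE.IsGSEStarRun Q r η γ xInit xGoal (fun n => X n ω) (G ω)) →
        limsup (fun n => GSE.failProb μ xInit xGoal G n) atTop = 0) ∧
    (∀ G : Ω → ℕ → GSE.PlanGraph d,
      (∀ ω, GSE.IsGSERun Q r xInit xGoal (fun n => X n ω) (G ω)) →
        limsup (fun n => GSE.failProb μ xInit xGoal G n) atTop = 0) ∧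
    (∃ a b : ℝ, 0 < a ∧ 0 < b ∧ ∀ G : Ω → ℕ → GSE.PlanGraph d,
      (∀ ω, GSE.IsGSERun Q r xInit xGoal (fun n => X n ω) (G ω)) →
        ∀ n, GSE.failProb μ xInit xGoal G n ≤ ENNReal.ofReal (a * Real.exp (-b * n))) := by
  obtain ⟨a, b, ha, hb, hab⟩ := GSE.exists_failProb_le hpath hr hX_meas hX_indep hX_unif
  refine ⟨fun G hG => ?_, fun G hG => ?_, a, b, ha, hb, fun G hG => ?_⟩
  · exact GSE.limsup_eq_zero_of_le_exp hb
      (hab G fun ω => ⟨(hG ω).1, fun n => ((hG ω).2 n).growStep⟩)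
  · exact GSE.limsup_eq_zero_of_le_exp hb
      (hab G fun ω => ⟨(hG ω).1, fun n => ((hG ω).2 n).growStep⟩)
  · exact hab G fun ω => ⟨(hG ω).1, fun n => ((hG ω).2 n).growStep⟩
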